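/- Write $\mathbb{N}=\{1,2,3,\ldots\}$. Define the Lüroth map $T:(0,1]\to(0,1]$ by $T(x)=\lfloor 1/x\rfloor\,(\lfloor 1/x+1\rfloor x-1)$, and for $x\in(0,1]$ let the Lüroth digits of $x$ be $d_1(x)=\lfloor 1/x\rfloor+1$ and $d_n(x)=d_1(T^{n-1}(x))$ for $n\ge 2$. Writing $d_j=d_j(x)$, for $n\in\mathbb{N}$ let $$Q_n(x)=d_n\prod_{j=1}^{n-1}d_j(d_j-1),\qquad P_n(x)=Q_n(x)\sum_{k=1}^{n}\frac{1}{d_k\prod_{j=1}^{k-1}d_j(d_j-1)},$$ so that $P_n(x)/Q_n(x)$ is the $n$-th Lüroth convergent of $x$. For $\psi:\mathbb{N}\to(0,1]$ let $$L(\psi)=\limsup_{n\to\infty}\left\{x\in(0,1]:\left|x-\frac{P_n(x)}{Q_n(x)}\right|<\frac{\psi(Q_n(x))}{Q_n(x)}\right\},$$ that is, the set of $x\in(0,1]$ for which the inequality holds for infinitely many $n$. **Theorem.** Let $\psi:\mathbb{N}\to(0,1]$ be non-increasing and not identically $1$. Then $L(\psi)$ is measurable and its Lebesgue measure is $$\mathcal{L}(L(\psi))=\begin{cases}0,&\text{if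 }\displaystyle\sum_{q=1}^{\infty}\frac{-\psi(q)\log\psi(q)}{q}<+\infty;\\[2ex]1,&\text{if }\displaystyle\sum_{q=1}^{\infty}\frac{-\psi(q)\log\psi(q)}{q}=+\infty.\end{cases}$$ -/

import Mathlib

noncomputable section

namespace Luroth

/-- The Lüroth map `T x = ⌊1/x⌋ (⌊1/x + 1⌋ x - 1)`, which maps `(0,1]` to itself. Only its values
on `(0,1]` matter. -/
def T (x : ℝ) : ℝ := (⌊1 / x⌋ : ℝ) * ((⌊1 / x + 1⌋ : ℝ) * x - 1)

/-- The first Lüroth digit `d₁(x) = ⌊1/x⌋ + 1`, for `x ∈ (0,1]`. -/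
def firstDigit (x : ℝ) : ℕ := ⌊1 / x⌋₊ + 1

/-- The `n`-th Lüroth digit `dₙ(x) = d₁(T^(n-1) x)`, for `n ≥ 1`. -/
def digit (n : ℕ) (x : ℝ) : ℕ := firstDigit (T^[n - 1] x)

/-- The `n`-th Lüroth convergent
`[d₁, …, dₙ] = ∑_{k=1}^n 1 / (dₖ ∏_{j=1}^{k-1} dⱼ (dⱼ - 1))`. -/
def convergent (n : ℕ) (x : ℝ) : ℝ :=
  ∑ k ∈ Finset.Icc 1 n,
    1 / ((digit k x : ℝ) * ∏ j ∈ Finset.Ico 1 k, (digit j x : ℝ) * ((digit j x : ℝ) - 1))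

/-- The unsimplified denominator `Qₙ(x) = dₙ ∏_{j=1}^{n-1} dⱼ (dⱼ - 1)`. It is a natural number
because every digit is at least `1` by definition, so the subtraction is exact. -/
def Q (n : ℕ) (x : ℝ) : ℕ :=
  digit n x * ∏ j ∈ Finset.Ico 1 n, digit j x * (digit j x - 1)

/-- The unsimplified numerator `Pₙ(x) = [d₁, …, dₙ] Qₙ(x)`. -/
def P (n : ℕ) (x : ℝ) : ℝ := convergent n x * (Q n x : ℝ)

/-- The set `L(ψ)` of Lüroth `ψ`-well approximable numbers: those `x ∈ (0,1]` with
`|x - Pₙ(x)/Qₙ(x)| < ψ(Qₙ(x))/Qₙ(x)` for infinitely many `n`. -/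
def L (ψ : ℕ → ℝ) : Set ℝ :=
  Filter.limsup
    (fun n : ℕ => {x : ℝ | x ∈ Set.Ioc (0 : ℝ) 1 ∧
      |x - P n x / (Q n x : ℝ)| < ψ (Q n x) / (Q n x : ℝ)})
    Filter.atTop

end Luroth

end

open MeasureTheory Filter Set
open scoped ENNReal Topology

namespace Luroth

/-! ### The Lüroth map and its inverse branches -/

/-! The error is exact: `x - convergent n x = T^[n] x / scale n x`. Since Q_{n+1} = d_{n+1} ·
scale_n, the inequality of rank n+1 becomes T^{n+1}x < ψ(d_{n+1} · scale_n)(d_{n+1} - 1), in which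
the past enters only through the scale (`mem_approxSet_succ`). Under Lebesgue measure a digit d has
probability 1/(d(d-1)) and is independent of the uniformly distributed tail
(`lintegral_firstDigit_T`), so at scale N the inequality has probability `cutoffSum ψ N`.

The scale is at least 2^n everywhere and, almost surely, eventually at most 2^(an)
(`exists_scale_le`). As `cutoffSum` is antitone in N, both cases are governed by ∑ `cutoffSum ψ
(2^k)`. Convergence gives measure 0 by the first Borel–Cantelli lemma. For divergence, T^{n+1}x is
replaced by its upper bound 1/(d_{n+2} - 1) and the scale by 2^(an). The resulting events for even n
involve disjoint pairs of digits, hence are independent, and the second Borel–Cantelli lemma gives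
measure 1.

Finally, condensation turns `cutoffSum ψ (2^k)` into ∑_j min(2^-j, ψ(2^(j+k))). Summed over k along
the antidiagonals j + k = s, this is comparable to ∑_s `gauge (ψ (2^s))`, up to a convergent error,
hence to ∑ `gauge (ψ q)` / q. Because ψ is not identically 1, -log ψ is eventually bounded below,
and `gauge ψ` may be replaced by -ψ log ψ. -/

lemma measurable_T : Measurable T := by
  unfold T
  fun_prop

lemma measurable_firstDigit : Measurable firstDigit := by
  unfold firstDigit
  fun_prop

lemma measurable_digit (n : ℕ) : Measurable (digit n) :=
  measurable_firstDigit.comp (measurable_T.iterate _)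

lemma one_le_floor {x : ℝ} (hx : x ∈ Ioc (0 : ℝ) 1) : 1 ≤ ⌊1 / x⌋₊ := by
  rw [Nat.one_le_floor_iff]
  exact (one_le_div hx.1).2 hx.2

lemma two_le_firstDigit {x : ℝ} (hx : x ∈ Ioc (0 : ℝ) 1) : 2 ≤ firstDigit x := by
  have := one_le_floor hx
  unfold firstDigit
  omega

lemma T_eq {x : ℝ} (hx : x ∈ Ioc (0 : ℝ) 1) :
    T x = ((firstDigit x : ℝ) - 1) * (firstDigit x * x - 1) := by
  have h : ((⌊1 / x⌋ : ℤ) : ℝ) = (⌊1 / x⌋₊ : ℝ) :=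
    (natCast_floor_eq_intCast_floor (one_div_pos.2 hx.1).le).symm
  simp only [T, firstDigit, Int.floor_add_one]
  push_cast
  rw [h]
  ring

lemma one_lt_firstDigit_mul {x : ℝ} (hx : x ∈ Ioc (0 : ℝ) 1) : 1 < firstDigit x * x := by
  have := Nat.lt_floor_add_one (1 / x)
  rw [div_lt_iff₀ hx.1] at this
  simpa [firstDigit] using this

lemma firstDigit_sub_one_mul_le {x : ℝ} (hx : x ∈ Ioc (0 : ℝ) 1) :
    ((firstDigit x : ℝ) - 1) * x ≤ 1 := by
  have := Nat.floor_le (one_div_pos.2 hx.1).le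
  rw [le_div_iff₀ hx.1] at this
  simpa [firstDigit] using this

lemma mapsTo_T : MapsTo T (Ioc 0 1) (Ioc 0 1) := by
  intro x hx
  have h2 : (2 : ℝ) ≤ firstDigit x := mod_cast two_le_firstDigit hx
  have h3 := one_lt_firstDigit_mul hx
  have h4 := firstDigit_sub_one_mul_le hx
  rw [T_eq hx]
  constructor
  · apply mul_pos <;> linarith
  · nlinarith

lemma iterate_T_mem {x : ℝ} (hx : x ∈ Ioc (0 : ℝ) 1) (n : ℕ) : T^[n] x ∈ Ioc (0 : ℝ) 1 :=
  mapsTo_T.iterate n hx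

/-- The inverse branch of the Lüroth map with values in `(1 / (m + 2), 1 / (m + 1)]`. -/
noncomputable def branch (m : ℕ) (y : ℝ) : ℝ := (y / (m + 1) + 1) / (m + 2)

lemma branch_mem {y : ℝ} (hy : y ∈ Ioc (0 : ℝ) 1) (m : ℕ) : branch m y ∈ Ioc (0 : ℝ) 1 := by
  have h : y / (m + 1) ≤ 1 := by
    rw [div_le_one (by positivity)]
    have : (0 : ℝ) ≤ m := by positivity
    linarith [hy.2]
  have h' : 0 < y / (m + 1) := div_pos hy.1 (by positivity)
  constructor
  · unfold branch
    positivity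
  · unfold branch
    rw [div_le_one (by positivity)]
    have : (0 : ℝ) ≤ m := by positivity
    linarith

lemma firstDigit_branch {y : ℝ} (hy : y ∈ Ioc (0 : ℝ) 1) (m : ℕ) :
    firstDigit (branch m y) = m + 2 := by
  have hb := (branch_mem hy m).1
  have key : ⌊1 / branch m y⌋₊ = m + 1 := by
    rw [Nat.floor_eq_iff (one_div_pos.2 hb).le, le_div_iff₀ hb, div_lt_iff₀ hb]
    have e : branch m y * ((m + 1) * (m + 2)) = y + (m + 1) := by
      unfold branch
      field_simp
    have hm : (0 : ℝ) < m + 1 := by positivity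
    push_cast
    constructor
    · have : (((m : ℝ) + 1) * branch m y) * (m + 2) ≤ 1 * (m + 2) := by linarith [hy.2]
      exact le_of_mul_le_mul_right this (by positivity)
    · have : 1 * ((m : ℝ) + 1) < (((m : ℝ) + 1 + 1) * branch m y) * (m + 1) := by linarith [hy.1]
      exact lt_of_mul_lt_mul_right this (by positivity)
  rw [firstDigit, key]

lemma T_branch {y : ℝ} (hy : y ∈ Ioc (0 : ℝ) 1) (m : ℕ) : T (branch m y) = y := by
  rw [T_eq (branch_mem hy m), firstDigit_branch hy m]
  unfold branch
  push_cast
  field_simp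
  ring

lemma branch_T {x : ℝ} (hx : x ∈ Ioc (0 : ℝ) 1) : branch (firstDigit x - 2) (T x) = x := by
  obtain ⟨m, hm⟩ := Nat.exists_eq_add_of_le' (two_le_firstDigit hx)
  rw [T_eq hx, hm]
  unfold branch
  simp only [Nat.add_sub_cancel]
  push_cast
  field_simp
  ring

lemma iUnion_image_branch : ⋃ m, branch m '' Ioc 0 1 = Ioc (0 : ℝ) 1 := by
  ext x
  simp only [mem_iUnion, mem_image]
  constructor
  · rintro ⟨m, y, hy, rfl⟩
    exact branch_mem hy m
  · exact fun hx => ⟨_, T x, mapsTo_T hx, branch_T hx⟩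

lemma pairwise_disjoint_image_branch :
    Pairwise (Function.onFun Disjoint fun m => branch m '' Ioc (0 : ℝ) 1) := by
  intro m n hmn
  rw [Function.onFun, Set.disjoint_left]
  rintro _ ⟨y, hy, rfl⟩ ⟨z, hz, h⟩
  apply hmn
  have := congrArg firstDigit h
  rw [firstDigit_branch hy, firstDigit_branch hz] at this
  omega

lemma injOn_branch (m : ℕ) : InjOn (branch m) (Ioc 0 1) := fun y hy z hz h => by
  rw [← T_branch hy m, h, T_branch hz m]

lemma hasDerivAt_branch (m : ℕ) (y : ℝ) :
    HasDerivAt (branch m) (1 / ((m + 1) * (m + 2))) y := by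
  have := (((hasDerivAt_id y).div_const ((m : ℝ) + 1)).add_const 1).div_const ((m : ℝ) + 2)
  rw [div_div] at this
  exact this

/-! ### Independence of the digits under Lebesgue measure -/

/-- Lebesgue measure on the unit interval `(0, 1]`. -/
noncomputable def unitMeasure : Measure ℝ := volume.restrict (Ioc 0 1)

instance : IsProbabilityMeasure unitMeasure := ⟨by simp [unitMeasure]⟩

lemma ae_mem_unit : ∀ᵐ x ∂unitMeasure, x ∈ Ioc (0 : ℝ) 1 := ae_restrict_mem measurableSet_Ioc

/-- Lebesgue measure of the set of points with first digit `m + 2`. -/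
noncomputable def digitWeight (m : ℕ) : ℝ≥0∞ := ENNReal.ofReal (1 / ((m + 1) * (m + 2)))

lemma digitWeight_ne_top (m : ℕ) : digitWeight m ≠ ⊤ := ENNReal.ofReal_ne_top

/-- Under Lebesgue measure, the first digit and the image under the Lüroth map are independent and
the latter is uniformly distributed. -/
lemma lintegral_firstDigit_T (G : ℕ → ℝ → ℝ≥0∞) :
    ∫⁻ x, G (firstDigit x) (T x) ∂unitMeasure
      = ∑' m : ℕ, digitWeight m * ∫⁻ y, G (m + 2) y ∂unitMeasure := by
  have hmeas (m : ℕ) : MeasurableSet (branch m '' Ioc 0 1) :=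
    measurableSet_Ioc.image_of_continuousOn_injOn
      (fun y _ => (hasDerivAt_branch m y).continuousAt.continuousWithinAt) (injOn_branch m)
  conv_lhs => rw [unitMeasure, ← iUnion_image_branch]
  rw [lintegral_iUnion hmeas pairwise_disjoint_image_branch]
  congr 1
  ext m
  -- Each branch is affine, so its Jacobian is the constant `digitWeight m`. This constant is finite
  -- and can be pulled out without any measurability of `G`.
  rw [lintegral_image_eq_lintegral_abs_deriv_mul measurableSet_Ioc
    (fun y _ => (hasDerivAt_branch m y).hasDerivWithinAt) (injOn_branch m),
    setLIntegral_congr_fun (g := fun y => digitWeight m * G (m + 2) y) measurableSet_Ioc,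
    lintegral_const_mul' _ _ (digitWeight_ne_top m), unitMeasure]
  intro y hy
  simp only [firstDigit_branch hy, T_branch hy, digitWeight]
  rw [abs_of_nonneg (by positivity)]

lemma tsum_digitWeight : ∑' m, digitWeight m = 1 := by
  simpa using (lintegral_firstDigit_T fun _ _ => 1).symm

lemma measurePreserving_T : MeasurePreserving T unitMeasure unitMeasure := by
  refine ⟨measurable_T, Measure.ext fun s hs => ?_⟩
  rw [Measure.map_apply measurable_T hs, ← lintegral_indicator_one (measurable_T hs)]
  have := lintegral_firstDigit_T fun _ y => s.indicator 1 y
  simp only [lintegral_indicator_one hs, ENNReal.tsum_mul_right, tsum_digitWeight, one_mul] at this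
  exact this

/-! ### The error of the convergents -/

/-- The product `∏_{j=1}^n dⱼ (dⱼ - 1)`, the inverse length of the cylinder of rank `n` at `x`. -/
noncomputable def scale (n : ℕ) (x : ℝ) : ℕ := ∏ j ∈ Finset.Ico 1 (n + 1), digit j x * (digit j x - 1)

lemma digit_succ (n : ℕ) (x : ℝ) : digit (n + 1) x = firstDigit (T^[n] x) := rfl

lemma two_le_digit {x : ℝ} (hx : x ∈ Ioc (0 : ℝ) 1) (n : ℕ) : 2 ≤ digit n x :=
  two_le_firstDigit (iterate_T_mem hx _)

lemma scale_zero (x : ℝ) : scale 0 x = 1 := by simp [scale]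

lemma scale_succ (n : ℕ) (x : ℝ) :
    scale (n + 1) x = scale n x * (digit (n + 1) x * (digit (n + 1) x - 1)) :=
  Finset.prod_Ico_succ_top (by omega) _

lemma Q_succ (n : ℕ) (x : ℝ) : Q (n + 1) x = digit (n + 1) x * scale n x := rfl

lemma two_pow_le_scale {x : ℝ} (hx : x ∈ Ioc (0 : ℝ) 1) (n : ℕ) : 2 ^ n ≤ scale n x := by
  induction n with
  | zero => simp [scale_zero]
  | succ n ih =>
    rw [scale_succ, pow_succ]
    have h := two_le_digit hx (n + 1)
    have : 2 * 1 ≤ digit (n + 1) x * (digit (n + 1) x - 1) := Nat.mul_le_mul h (by omega)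
    exact Nat.mul_le_mul ih this

lemma scale_pos {x : ℝ} (hx : x ∈ Ioc (0 : ℝ) 1) (n : ℕ) : 0 < scale n x :=
  (Nat.two_pow_pos n).trans_le (two_pow_le_scale hx n)

lemma cast_scale {x : ℝ} (hx : x ∈ Ioc (0 : ℝ) 1) (n : ℕ) :
    (scale n x : ℝ) = ∏ j ∈ Finset.Ico 1 (n + 1), (digit j x : ℝ) * ((digit j x : ℝ) - 1) := by
  unfold scale
  push_cast
  refine Finset.prod_congr rfl fun j _ => ?_
  have := two_le_digit hx j
  rw [Nat.cast_sub (by omega)]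
  simp

lemma convergent_succ {x : ℝ} (hx : x ∈ Ioc (0 : ℝ) 1) (n : ℕ) :
    convergent (n + 1) x = convergent n x + 1 / ((digit (n + 1) x : ℝ) * scale n x) := by
  rw [convergent, Finset.sum_Icc_succ_top (by omega), cast_scale hx]
  rfl

/-- Iteration of x = 1/d + T x / (d (d - 1)) with d the first digit. -/
lemma sub_convergent {x : ℝ} (hx : x ∈ Ioc (0 : ℝ) 1) (n : ℕ) :
    x - convergent n x = T^[n] x / scale n x := by
  induction n with
  | zero => simp [convergent, scale_zero]
  | succ n ih =>
    have h2 := two_le_digit hx (n + 1)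
    have h2' : (2 : ℝ) ≤ digit (n + 1) x := mod_cast h2
    have hs : (0 : ℝ) < scale n x := mod_cast scale_pos hx n
    have hd : (digit (n + 1) x : ℝ) ≠ 0 := by linarith
    have hd' : (digit (n + 1) x : ℝ) - 1 ≠ 0 := by linarith
    rw [convergent_succ hx, scale_succ, ← sub_sub, ih, Function.iterate_succ_apply',
      T_eq (iterate_T_mem hx n), ← digit_succ]
    push_cast [Nat.cast_sub (show 1 ≤ digit (n + 1) x by omega)]
    field_simp

/-- The set of points that are well approximated by their convergent of rank `n`. -/
def approxSet (ψ : ℕ → ℝ) (n : ℕ) : Set ℝ :=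
  {x : ℝ | x ∈ Ioc (0 : ℝ) 1 ∧ |x - P n x / (Q n x : ℝ)| < ψ (Q n x) / (Q n x : ℝ)}

lemma L_eq (ψ : ℕ → ℝ) : L ψ = limsup (approxSet ψ) atTop := rfl

lemma mem_approxSet_succ (ψ : ℕ → ℝ) {x : ℝ} (hx : x ∈ Ioc (0 : ℝ) 1) (n : ℕ) :
    x ∈ approxSet ψ (n + 1) ↔
      T (T^[n] x) < ψ (firstDigit (T^[n] x) * scale n x) * ((firstDigit (T^[n] x) : ℝ) - 1) := by
  have h2 := two_le_digit hx (n + 1)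
  have h2' : (2 : ℝ) ≤ digit (n + 1) x := mod_cast h2
  have hs : (0 : ℝ) < scale n x := mod_cast scale_pos hx n
  have hQ : (Q (n + 1) x : ℝ) ≠ 0 := by
    rw [Q_succ]
    push_cast
    positivity
  have hT := (iterate_T_mem hx (n + 1)).1
  have hd' : 0 < (digit (n + 1) x : ℝ) - 1 := by linarith
  rw [Function.iterate_succ_apply'] at hT
  simp only [approxSet, mem_ofPred_eq, hx, true_and, P, mul_div_cancel_right₀ _ hQ]
  rw [sub_convergent hx, scale_succ, Function.iterate_succ_apply', Q_succ, ← digit_succ]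
  push_cast [Nat.cast_sub (show 1 ≤ digit (n + 1) x by omega)]
  rw [abs_of_pos (by positivity), ← mul_assoc (scale n x : ℝ), div_mul_eq_div_div,
    div_lt_iff₀' hd', mul_comm (scale n x : ℝ), div_lt_iff₀ (by positivity)]
  field_simp

/-! ### Measurability of the limsup set -/

lemma measurable_Q (n : ℕ) : Measurable (Q n) := by
  have h := measurable_digit
  have h' (j : ℕ) : Measurable fun x => digit j x - 1 :=
    (measurable_of_countable fun d : ℕ => d - 1).comp (h j)
  unfold Q
  fun_prop

lemma measurable_convergent (n : ℕ) : Measurable (convergent n) := by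
  have h (j : ℕ) : Measurable fun x => (digit j x : ℝ) :=
    (measurable_of_countable fun d : ℕ => (d : ℝ)).comp (measurable_digit j)
  unfold convergent
  fun_prop

lemma measurableSet_approxSet (ψ : ℕ → ℝ) (n : ℕ) : MeasurableSet (approxSet ψ n) := by
  have hQ := measurable_Q n
  have h1 : Measurable fun x => (Q n x : ℝ) :=
    (measurable_of_countable fun d : ℕ => (d : ℝ)).comp hQ
  have h2 : Measurable fun x => ψ (Q n x) := (measurable_of_countable ψ).comp hQ
  have h3 := measurable_convergent n
  unfold approxSet P
  refine measurableSet_Ioc.inter (measurableSet_lt ?_ (h2.div h1))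
  exact (measurable_id.sub ((h3.mul h1).div h1)).abs

lemma measurableSet_L (ψ : ℕ → ℝ) : MeasurableSet (L ψ) :=
  MeasurableSet.measurableSet_limsup (measurableSet_approxSet ψ)

lemma L_subset (ψ : ℕ → ℝ) : L ψ ⊆ Ioc 0 1 := by
  intro x hx
  rw [L_eq, mem_limsup_iff_frequently_mem] at hx
  obtain ⟨n, hn⟩ := hx.exists
  exact hn.1

lemma volume_L (ψ : ℕ → ℝ) : volume (L ψ) = unitMeasure (L ψ) := by
  rw [unitMeasure, Measure.restrict_apply (measurableSet_L ψ), inter_eq_left.2 (L_subset ψ)]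

/-! ### The series attached to an approximation function -/

/-- The function `t ↦ t (1 + log (1 / t))`. -/
noncomputable def gauge (t : ℝ) : ℝ := t * (1 - Real.log t)

/-- The derivative of t (1 - log t) is -log t, which is nonnegative on (0, 1]. The function -t log t
is not monotone there, which is why `gauge` is used in its place. The proof needs only log u ≤ u - 1
at u = t / s. -/
lemma gauge_le_gauge {s t : ℝ} (hs : 0 < s) (hst : s ≤ t) (ht : t ≤ 1) : gauge s ≤ gauge t := by
  have ht0 : 0 < t := hs.trans_le hst
  have h1 := Real.log_le_sub_one_of_pos (div_pos ht0 hs)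
  rw [Real.log_div ht0.ne' hs.ne'] at h1
  have h2 : s * (Real.log t - Real.log s) ≤ t - s := by
    calc s * (Real.log t - Real.log s) ≤ s * (t / s - 1) := by gcongr
      _ = t - s := by field_simp
  have h3 := Real.log_nonpos ht0.le ht
  unfold gauge
  nlinarith

lemma gauge_nonneg {t : ℝ} (ht : t ∈ Ioc (0 : ℝ) 1) : 0 ≤ gauge t := by
  have := Real.log_nonpos ht.1.le ht.2
  exact mul_nonneg ht.1.le (by linarith)

lemma exists_half_pow_near {t : ℝ} (ht : t ∈ Ioc (0 : ℝ) 1) :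
    ∃ J : ℕ, (1 / 2 : ℝ) ^ (J + 1) < t ∧ t ≤ (1 / 2) ^ J ∧
      J * Real.log 2 ≤ -Real.log t ∧ -Real.log t ≤ (J + 1) * Real.log 2 := by
  obtain ⟨J, h1, h2⟩ := exists_nat_pow_near_of_lt_one ht.1 ht.2 (y := (1 / 2 : ℝ))
    (by norm_num) (by norm_num)
  refine ⟨J, h1, h2, ?_, ?_⟩
  · have := Real.log_le_log ht.1 h2
    rw [Real.log_pow, one_div, Real.log_inv] at this
    linarith
  · have := Real.log_le_log (by positivity) h1.le
    rw [Real.log_pow, one_div, Real.log_inv] at this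
    push_cast at this
    linarith

/-- With J the dyadic order of t, the first J + 1 terms are at most t each and the others form a
geometric tail of sum at most 2t, while J is at most a multiple of -log t. -/
lemma sum_min_le_gauge {t : ℝ} (ht : t ∈ Ioc (0 : ℝ) 1) (N : ℕ) :
    ∑ j ∈ Finset.range N, min ((1 / 2 : ℝ) ^ j) t ≤ 3 * gauge t := by
  obtain ⟨J, h1, -, h3, -⟩ := exists_half_pow_near ht
  have ht0 := ht.1
  have hlog : Real.log t ≤ 0 := Real.log_nonpos ht.1.le ht.2
  have hl2 := Real.log_two_gt_d9
  calc ∑ j ∈ Finset.range N, min ((1 / 2 : ℝ) ^ j) t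
      -- Lengthening the range allows a split at J + 1 without comparing N with J.
      ≤ ∑ j ∈ Finset.range (J + 1 + N), min ((1 / 2 : ℝ) ^ j) t := by
        refine Finset.sum_le_sum_of_subset_of_nonneg (by simp) fun j _ _ => by positivity
    _ = ∑ j ∈ Finset.range (J + 1), min ((1 / 2 : ℝ) ^ j) t
        + ∑ j ∈ Finset.range N, min ((1 / 2 : ℝ) ^ (J + 1 + j)) t := Finset.sum_range_add _ _ _
    _ ≤ ∑ j ∈ Finset.range (J + 1), t + ∑ j ∈ Finset.range N, t * (1 / 2 : ℝ) ^ j := by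
        gcongr with j _ j _
        · exact min_le_right _ _
        · refine (min_le_left _ _).trans ?_
          rw [pow_add]
          gcongr
    _ ≤ (J + 1) * t + t * 2 := by
        rw [← Finset.mul_sum]
        gcongr
        · simp
        · have := sum_geometric_two_le N
          simpa using this
    _ ≤ 3 * gauge t := by
        have : (J : ℝ) ≤ 2 * -Real.log t := by
          have : (0 : ℝ) ≤ J := by positivity
          nlinarith
        unfold gauge
        nlinarith

/-- If the dyadic order J of t is at most s, the sum contains J + 1 terms equal to t. Otherwise t ≤
2^-s, and monotonicity of `gauge` gives the last term, which is summable in s. -/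
lemma gauge_le_sum_min {t : ℝ} (ht : t ∈ Ioc (0 : ℝ) 1) (s : ℕ) :
    gauge t ≤ 2 * ∑ j ∈ Finset.range (s + 1), min ((1 / 2 : ℝ) ^ j) t
      + (1 + s) * (1 / 2 : ℝ) ^ s := by
  obtain ⟨J, -, h2, -, h4⟩ := exists_half_pow_near ht
  have ht0 := ht.1
  have hl2 : Real.log 2 ≤ 1 := by linarith [Real.log_two_lt_d9]
  rcases le_or_gt J s with hJ | hJ
  · have hsum : (J + 1) * t ≤ ∑ j ∈ Finset.range (s + 1), min ((1 / 2 : ℝ) ^ j) t := by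
      calc (J + 1) * t = ∑ j ∈ Finset.range (J + 1), t := by simp
        _ ≤ ∑ j ∈ Finset.range (J + 1), min ((1 / 2 : ℝ) ^ j) t := by
          refine Finset.sum_le_sum fun j hj => le_min (h2.trans ?_) le_rfl
          exact pow_le_pow_of_le_one (by norm_num) (by norm_num)
            (Nat.lt_succ_iff.1 (Finset.mem_range.1 hj))
        _ ≤ _ := Finset.sum_le_sum_of_subset_of_nonneg
          (Finset.range_subset_range.2 (by omega)) fun j _ _ => by positivity
    have h5 : -Real.log t ≤ J + 1 := h4.trans (mul_le_of_le_one_right (by positivity) hl2)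
    have h6 : gauge t ≤ 2 * ((J + 1) * t) := by
      have : (0 : ℝ) ≤ J := by positivity
      unfold gauge
      nlinarith
    have : 0 ≤ (1 + s) * (1 / 2 : ℝ) ^ s := by positivity
    linarith
  · have h5 : t ≤ (1 / 2) ^ s :=
      h2.trans (pow_le_pow_of_le_one (by norm_num) (by norm_num) hJ.le)
    have h6 : gauge ((1 / 2) ^ s) ≤ (1 + s) * (1 / 2 : ℝ) ^ s := by
      unfold gauge
      rw [Real.log_pow, one_div, Real.log_inv, mul_comm]
      gcongr
      have : (0 : ℝ) ≤ s := by positivity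
      nlinarith
    have h7 : 0 ≤ ∑ j ∈ Finset.range (s + 1), min ((1 / 2 : ℝ) ^ j) t :=
      Finset.sum_nonneg fun j _ => by positivity
    have h8 := gauge_le_gauge ht0 h5 (pow_le_one₀ (by norm_num) (by norm_num))
    linarith

/-- Tonelli along the antidiagonals j + k = s, on which the value of `a` is constant. -/
lemma tsum_tsum_min (a : ℕ → ℝ) (ha : ∀ s, 0 ≤ a s) :
    ∑' k : ℕ, ∑' j : ℕ, ENNReal.ofReal (min ((1 / 2 : ℝ) ^ j) (a (j + k)))
      = ∑' s : ℕ, ENNReal.ofReal (∑ j ∈ Finset.range (s + 1), min ((1 / 2 : ℝ) ^ j) (a s)) := by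
  rw [ENNReal.tsum_comm, ← ENNReal.tsum_prod,
    ← Finset.HasAntidiagonal.sigmaAntidiagonalEquivProd.tsum_eq, ENNReal.tsum_sigma']
  congr 1
  ext s
  rw [ENNReal.ofReal_sum_of_nonneg fun j _ => le_min (by positivity) (ha s),
    ← Finset.Nat.sum_antidiagonal_eq_sum_range_succ_mk
      (fun p => ENNReal.ofReal (min ((1 / 2 : ℝ) ^ p.1) (a s))), tsum_fintype,
    ← Finset.sum_coe_sort (Finset.HasAntidiagonal.antidiagonal s)]
  refine Finset.sum_congr rfl fun p _ => ?_
  have := Finset.HasAntidiagonal.mem_antidiagonal.1 p.2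
  simp [Finset.HasAntidiagonal.sigmaAntidiagonalEquivProd_apply, this]

/-! ### Comparison of the cutoff sums with the gauge series -/

/-- The conditional probability `∑_d min (1 / (d (d - 1)), ψ (d N) / d)` that a point is well
approximated by its next convergent, given that the scale of its cylinder is `N`. -/
noncomputable def cutoffSum (ψ : ℕ → ℝ) (N : ℕ) : ℝ≥0∞ :=
  ∑' m : ℕ, ENNReal.ofReal (min (1 / ((m + 1) * (m + 2))) (ψ ((m + 2) * N) / (m + 2)))

variable {ψ : ℕ → ℝ}

lemma cutoffSum_antitone (hanti : AntitoneOn ψ (Ici 1)) {M N : ℕ} (hM : 1 ≤ M) (hMN : M ≤ N) :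
    cutoffSum ψ N ≤ cutoffSum ψ M := by
  unfold cutoffSum
  gcongr with m
  have h1 : 1 ≤ (m + 2) * M := Nat.mul_pos (by omega) hM
  have h2 : (m + 2) * M ≤ (m + 2) * N := by gcongr
  exact hanti h1 (h1.trans h2) h2

lemma cutoffSum_le_one (ψ : ℕ → ℝ) (N : ℕ) : cutoffSum ψ N ≤ 1 := by
  rw [← tsum_digitWeight]
  unfold cutoffSum digitWeight
  gcongr with m
  exact min_le_left _ _

/-- The summand of `cutoffSum` indexed by the digit minus one. -/
noncomputable def cutoffTerm (ψ : ℕ → ℝ) (N n : ℕ) : ℝ≥0∞ :=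
  ENNReal.ofReal (min (1 / (n * (n + 1))) (ψ ((n + 1) * N) / (n + 1)))

lemma cutoffTerm_antitone (hψ : ∀ q : ℕ, 1 ≤ q → ψ q ∈ Ioc (0 : ℝ) 1)
    (hanti : AntitoneOn ψ (Ici 1)) {N : ℕ} (hN : 1 ≤ N) ⦃m n : ℕ⦄ (hm : 0 < m) (hmn : m ≤ n) :
    cutoffTerm ψ N n ≤ cutoffTerm ψ N m := by
  unfold cutoffTerm
  have h1 : 1 ≤ (m + 1) * N := Nat.mul_pos (by omega) hN
  have h2 : (m + 1) * N ≤ (n + 1) * N := by gcongr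
  have h3 := hanti h1 (h1.trans h2) h2
  have h4 := (hψ _ h1).1.le
  gcongr

/-- Here 1 / 0 = 0, so starting the series at 0, as condensation requires, adds nothing. -/
lemma cutoffTerm_zero (ψ : ℕ → ℝ) (N : ℕ) : cutoffTerm ψ N 0 = 0 := by
  simp [cutoffTerm]

lemma tsum_cutoffTerm (ψ : ℕ → ℝ) (N : ℕ) : ∑' n, cutoffTerm ψ N n = cutoffSum ψ N := by
  rw [tsum_eq_zero_add' ENNReal.summable, cutoffTerm_zero, zero_add]
  unfold cutoffTerm cutoffSum
  congr 1
  ext m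
  push_cast
  norm_num [add_assoc]

/-- Cauchy condensation: the indices in [2^j, 2^(j+1)) contribute at most 2^j times the first term
of the block. -/
lemma cutoffSum_two_pow_le (hψ : ∀ q : ℕ, 1 ≤ q → ψ q ∈ Ioc (0 : ℝ) 1)
    (hanti : AntitoneOn ψ (Ici 1)) (k : ℕ) :
    cutoffSum ψ (2 ^ k) ≤
      ∑' j : ℕ, ENNReal.ofReal (min ((1 / 2 : ℝ) ^ j) (ψ (2 ^ (j + k)))) := by
  rw [← tsum_cutoffTerm]
  refine (ENNReal.le_tsum_condensed
    (cutoffTerm_antitone hψ hanti (Nat.one_le_two_pow (n := k)))).trans ?_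
  rw [cutoffTerm_zero, zero_add]
  gcongr with j
  have e : (2 : ℝ≥0∞) ^ j = ENNReal.ofReal (2 ^ j) := by simp [ENNReal.ofReal_pow]
  rw [e, cutoffTerm, ← ENNReal.ofReal_mul (by positivity), mul_min_of_nonneg _ _ (by positivity)]
  have h1 : (2 : ℕ) ^ (j + k) ≤ (2 ^ j + 1) * 2 ^ k := by
    rw [pow_add]
    gcongr
    omega
  have h2 : ψ ((2 ^ j + 1) * 2 ^ k) ≤ ψ (2 ^ (j + k)) :=
    hanti Nat.one_le_two_pow (Nat.one_le_two_pow.trans h1) h1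
  have h3 := (hψ _ (Nat.one_le_two_pow.trans h1)).1
  have hp : (0 : ℝ) < 2 ^ j := by positivity
  push_cast
  gcongr
  · rw [one_div_pow, mul_one_div, div_le_div_iff₀ (by positivity) (by positivity)]
    nlinarith
  · refine le_trans ?_ h2
    rw [← mul_div_assoc, div_le_iff₀ (by positivity)]
    nlinarith

/-- The converse half of condensation. The shift by 1 in the exponent absorbs the bound (2^j + 1)
2^k ≤ 2^(j+k+1), and 6 = 2 (1 + 2) collects the factor 2 lost per term and the constants of
condensation. -/
lemma tsum_min_le_cutoffSum_two_pow (hψ : ∀ q : ℕ, 1 ≤ q → ψ q ∈ Ioc (0 : ℝ) 1)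
    (hanti : AntitoneOn ψ (Ici 1)) (k : ℕ) :
    ∑' j : ℕ, ENNReal.ofReal (min ((1 / 2 : ℝ) ^ j) (ψ (2 ^ (j + k + 1)))) ≤
      6 * cutoffSum ψ (2 ^ k) := by
  have hterm (j : ℕ) : ENNReal.ofReal (min ((1 / 2 : ℝ) ^ j) (ψ (2 ^ (j + k + 1)))) ≤
      2 * (2 ^ j * cutoffTerm ψ (2 ^ k) (2 ^ j)) := by
    have e : (2 : ℝ≥0∞) * 2 ^ j = ENNReal.ofReal (2 * 2 ^ j) := by
      simp [ENNReal.ofReal_mul, ENNReal.ofReal_pow]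
    rw [← mul_assoc, e, cutoffTerm, ← ENNReal.ofReal_mul (by positivity),
      mul_min_of_nonneg _ _ (by positivity)]
    have h0 : 1 ≤ (2 ^ j + 1) * 2 ^ k := Nat.mul_pos (Nat.succ_pos _) (by positivity)
    have h1 : (2 ^ j + 1) * 2 ^ k ≤ 2 ^ (j + k + 1) := by
      have : 1 ≤ 2 ^ j := Nat.one_le_two_pow
      calc (2 ^ j + 1) * 2 ^ k ≤ (2 * 2 ^ j) * 2 ^ k := by gcongr; omega
        _ = 2 ^ (j + k + 1) := by ring
    have h2 := hanti h0 (h0.trans h1) h1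
    have h3 := (hψ _ h0).1
    have hp : (1 : ℝ) ≤ 2 ^ j := one_le_pow₀ (by norm_num)
    push_cast
    gcongr
    · rw [one_div_pow, mul_one_div, div_le_div_iff₀ (by positivity) (by positivity)]
      nlinarith
    · refine h2.trans ?_
      rw [← mul_div_assoc, le_div_iff₀ (by positivity)]
      nlinarith
  calc ∑' j : ℕ, ENNReal.ofReal (min ((1 / 2 : ℝ) ^ j) (ψ (2 ^ (j + k + 1))))
      ≤ ∑' j : ℕ, 2 * (2 ^ j * cutoffTerm ψ (2 ^ k) (2 ^ j)) := ENNReal.tsum_le_tsum hterm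
    _ = 2 * ∑' j : ℕ, 2 ^ j * cutoffTerm ψ (2 ^ k) (2 ^ j) := ENNReal.tsum_mul_left
    _ ≤ 2 * (cutoffTerm ψ (2 ^ k) 1 + 2 * ∑' n, cutoffTerm ψ (2 ^ k) n) := by
      gcongr
      exact ENNReal.tsum_condensed_le fun m n hm hmn =>
        cutoffTerm_antitone hψ hanti Nat.one_le_two_pow (by omega) hmn
    _ ≤ 2 * (∑' n, cutoffTerm ψ (2 ^ k) n + 2 * ∑' n, cutoffTerm ψ (2 ^ k) n) := by
      gcongr
      exact ENNReal.le_tsum 1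
    _ = 6 * cutoffSum ψ (2 ^ k) := by
      rw [tsum_cutoffTerm]
      ring

lemma summable_gauge_two_pow_iff (hψ : ∀ q : ℕ, 1 ≤ q → ψ q ∈ Ioc (0 : ℝ) 1)
    (hanti : AntitoneOn ψ (Ici 1)) :
    Summable (fun k : ℕ => gauge (ψ (2 ^ k))) ↔
      Summable fun q : ℕ => gauge (ψ (q + 1)) / ((q : ℝ) + 1) := by
  have h := summable_condensed_iff_of_nonneg (f := fun n : ℕ => gauge (ψ n) / n) ?_ ?_
  · rw [← summable_nat_add_iff (f := fun n : ℕ => gauge (ψ n) / n) 1] at h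
    push_cast at h
    rw [← h]
    refine summable_congr fun k => ?_
    field_simp
  · intro n
    rcases Nat.eq_zero_or_pos n with rfl | hn
    · simp
    · exact div_nonneg (gauge_nonneg (hψ n hn)) (by positivity)
  · intro m n hm hmn
    have h1 := gauge_le_gauge (hψ n (by omega)).1
      (hanti (show m ∈ Ici 1 from hm) (show n ∈ Ici 1 by simp; omega) hmn) (hψ m hm).2
    have h2 := gauge_nonneg (hψ m hm)
    have : (0 : ℝ) < m := mod_cast hm
    gcongr

lemma summable_gauge_iff (hψ : ∀ q : ℕ, 1 ≤ q → ψ q ∈ Ioc (0 : ℝ) 1)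
    (hanti : AntitoneOn ψ (Ici 1)) (hne : ∃ q : ℕ, 1 ≤ q ∧ ψ q ≠ 1) :
    (Summable fun q : ℕ => gauge (ψ (q + 1)) / ((q : ℝ) + 1)) ↔
      Summable fun q : ℕ => -ψ (q + 1) * Real.log (ψ (q + 1)) / ((q : ℝ) + 1) := by
  have hlog (q : ℕ) : Real.log (ψ (q + 1)) ≤ 0 :=
    Real.log_nonpos (hψ _ (by omega)).1.le (hψ _ (by omega)).2
  have hpos (q : ℕ) : 0 < ψ (q + 1) := (hψ _ (by omega)).1
  constructor <;> intro h
  · refine h.of_nonneg_of_le (fun q => ?_) fun q => ?_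
    · exact div_nonneg (by nlinarith [hlog q, hpos q]) (by positivity)
    · gcongr
      unfold gauge
      nlinarith [hpos q]
  · obtain ⟨r, hr, hr1⟩ := hne
    have hlt : ψ r < 1 := lt_of_le_of_ne (hψ r hr).2 hr1
    -- Beyond r, monotonicity gives -log ψ ≥ δ > 0, so the extra summand ψ of the gauge is at most
    -- (1/δ)(-ψ log ψ).
    set δ := -Real.log (ψ r) with hδ
    have hδ0 : 0 < δ := neg_pos.2 (Real.log_neg (hψ r hr).1 hlt)
    rw [← summable_nat_add_iff r] at h ⊢
    refine (h.mul_left (1 / δ + 1)).of_nonneg_of_le (fun q => ?_) fun q => ?_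
    · exact div_nonneg (gauge_nonneg (hψ _ (by omega))) (by positivity)
    · have h1 : ψ (q + r + 1) ≤ ψ r :=
        hanti (show r ∈ Ici 1 from hr) (show q + r + 1 ∈ Ici 1 by simp) (by omega)
      have h2 : δ ≤ -Real.log (ψ (q + r + 1)) := by
        have := Real.log_le_log (hpos (q + r)) h1
        linarith
      have h3 : 1 ≤ 1 / δ * -Real.log (ψ (q + r + 1)) := by
        rw [one_div_mul_eq_div, le_div_iff₀ hδ0]
        linarith
      rw [← mul_div_assoc]
      gcongr
      unfold gauge
      nlinarith [hpos (q + r)]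

lemma tsum_cutoffSum_ne_top (hψ : ∀ q : ℕ, 1 ≤ q → ψ q ∈ Ioc (0 : ℝ) 1)
    (hanti : AntitoneOn ψ (Ici 1)) (h : Summable fun k : ℕ => gauge (ψ (2 ^ k))) :
    ∑' k : ℕ, cutoffSum ψ (2 ^ k) ≠ ⊤ := by
  have hle : ∑' k : ℕ, cutoffSum ψ (2 ^ k) ≤
      ∑' s : ℕ, ENNReal.ofReal (3 * gauge (ψ (2 ^ s))) := by
    refine (ENNReal.tsum_le_tsum (cutoffSum_two_pow_le hψ hanti)).trans ?_
    rw [tsum_tsum_min (fun s => ψ (2 ^ s)) fun s => (hψ _ Nat.one_le_two_pow).1.le]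
    gcongr with s
    exact sum_min_le_gauge (hψ _ Nat.one_le_two_pow) _
  exact ne_top_of_le_ne_top (h.mul_left 3).tsum_ofReal_ne_top hle

lemma summable_gauge_of_tsum_cutoffSum_ne_top (hψ : ∀ q : ℕ, 1 ≤ q → ψ q ∈ Ioc (0 : ℝ) 1)
    (hanti : AntitoneOn ψ (Ici 1)) (h : ∑' k : ℕ, cutoffSum ψ (2 ^ k) ≠ ⊤) :
    Summable fun k : ℕ => gauge (ψ (2 ^ k)) := by
  have hmem (s : ℕ) : ψ (2 ^ (s + 1)) ∈ Ioc (0 : ℝ) 1 := hψ _ Nat.one_le_two_pow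
  have hfin : ∑' s : ℕ, ENNReal.ofReal
      (∑ j ∈ Finset.range (s + 1), min ((1 / 2 : ℝ) ^ j) (ψ (2 ^ (s + 1)))) ≠ ⊤ := by
    rw [← tsum_tsum_min (fun s => ψ (2 ^ (s + 1))) fun s => (hmem s).1.le]
    refine ne_top_of_le_ne_top ?_
      (ENNReal.tsum_le_tsum (tsum_min_le_cutoffSum_two_pow hψ hanti))
    rw [ENNReal.tsum_mul_left]
    exact ENNReal.mul_ne_top (by simp) h
  have hnn (s : ℕ) : 0 ≤ ∑ j ∈ Finset.range (s + 1), min ((1 / 2 : ℝ) ^ j) (ψ (2 ^ (s + 1))) :=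
    Finset.sum_nonneg fun j _ => le_min (by positivity) (hmem s).1.le
  have hsum := ENNReal.summable_toReal hfin
  simp only [ENNReal.toReal_ofReal (hnn _)] at hsum
  have hgeom : Summable fun s : ℕ => (1 + s) * (1 / 2 : ℝ) ^ s := by
    have h0 := summable_geometric_two
    have h1 := summable_pow_mul_geometric_of_norm_lt_one (R := ℝ) 1 (r := 1 / 2) (by norm_num)
    exact (h0.add h1).congr fun s => by ring
  rw [← summable_nat_add_iff 1]
  exact ((hsum.mul_left 2).add hgeom).of_nonneg_of_le (fun s => gauge_nonneg (hmem s))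
    fun s => gauge_le_sum_min (hmem s) s

/-- Schlömilch condensation along multiples of a: every gap has length a, so the full series is at
most a finite initial sum plus a times the sparse series. -/
lemma tsum_cutoffSum_pow_eq_top (hanti : AntitoneOn ψ (Ici 1)) {a : ℕ} (ha : 0 < a)
    (h : ∑' k : ℕ, cutoffSum ψ (2 ^ k) = ⊤) : ∑' k : ℕ, cutoffSum ψ (2 ^ (a * k)) = ⊤ := by
  have hle := ENNReal.le_tsum_schlomilch (f := fun k => cutoffSum ψ (2 ^ k))
    (u := fun k => a * (k + 1))
    (fun m n _ hmn => cutoffSum_antitone hanti Nat.one_le_two_pow 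
      (pow_le_pow_right₀ one_le_two hmn))
    (fun n => by positivity) (fun m n hmn => Nat.mul_lt_mul_of_pos_left (by omega) ha)
  rw [h, top_le_iff] at hle
  by_contra hfin
  refine (ENNReal.add_ne_top.2 ⟨?_, ?_⟩) hle
  · exact (ENNReal.sum_lt_top.2 fun k _ =>
      (cutoffSum_le_one ψ _).trans_lt ENNReal.one_lt_top).ne
  · have hterm (k : ℕ) : (((a * (k + 1 + 1) : ℕ) : ℝ≥0∞) - ((a * (k + 1) : ℕ) : ℝ≥0∞))
        * cutoffSum ψ (2 ^ (a * (k + 1))) = a * cutoffSum ψ (2 ^ (a * (k + 1))) := by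
      rw [← ENNReal.natCast_sub, ← Nat.mul_sub]
      simp
    simp only [hterm]
    rw [ENNReal.tsum_mul_left]
    refine ENNReal.mul_ne_top (by simp) (ne_top_of_le_ne_top hfin ?_)
    exact ENNReal.tsum_comp_le_tsum_of_injective (add_left_injective 1)
      fun k => cutoffSum ψ (2 ^ (a * k))

/-! ### The convergence case -/

lemma unitMeasure_Iio_le (c : ℝ) : unitMeasure (Iio c) ≤ ENNReal.ofReal (min 1 c) := by
  rw [ENNReal.ofReal_min]
  refine le_min (by simpa using prob_le_one) ?_
  rw [unitMeasure, Measure.restrict_apply measurableSet_Iio]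
  calc volume (Iio c ∩ Ioc 0 1) ≤ volume (Ioo 0 c) := measure_mono fun y hy => ⟨hy.2.1, hy.1⟩
    _ = ENNReal.ofReal c := by simp

lemma digitWeight_mul_ofReal_min (m : ℕ) (t : ℝ) :
    digitWeight m * ENNReal.ofReal (min 1 (t * (m + 1)))
      = ENNReal.ofReal (min (1 / ((m + 1) * (m + 2))) (t / (m + 2))) := by
  rw [digitWeight, ← ENNReal.ofReal_mul (by positivity), mul_min_of_nonneg _ _ (by positivity)]
  congr 2
  · ring
  · field_simp

lemma cast_add_two_sub_one (m : ℕ) : ((m + 2 : ℕ) : ℝ) - 1 = m + 1 := by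
  push_cast
  ring

/-- The points that are well approximated by their first convergent, for the approximation function
rescaled by `N`. -/
def rescaledApproxSet (ψ : ℕ → ℝ) (N : ℕ) : Set ℝ :=
  {y | T y < ψ (firstDigit y * N) * ((firstDigit y : ℝ) - 1)}

lemma measurable_comp_firstDigit (g : ℕ → ℝ) : Measurable fun y => g (firstDigit y) :=
  (measurable_of_countable g).comp measurable_firstDigit

lemma measurableSet_rescaledApproxSet (ψ : ℕ → ℝ) (N : ℕ) :
    MeasurableSet (rescaledApproxSet ψ N) :=
  measurableSet_lt measurable_T
    (measurable_comp_firstDigit fun d => ψ (d * N) * ((d : ℝ) - 1))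

lemma unitMeasure_rescaledApproxSet_le (ψ : ℕ → ℝ) (N : ℕ) :
    unitMeasure (rescaledApproxSet ψ N) ≤ cutoffSum ψ N := by
  rw [← lintegral_indicator_one (measurableSet_rescaledApproxSet ψ N)]
  have h := lintegral_firstDigit_T
    fun d => (Iio (ψ (d * N) * ((d : ℝ) - 1))).indicator (1 : ℝ → ℝ≥0∞)
  simp only [lintegral_indicator_one measurableSet_Iio] at h
  refine h.le.trans (ENNReal.tsum_le_tsum fun m => ?_)
  rw [← digitWeight_mul_ofReal_min, cast_add_two_sub_one]
  gcongr
  exact unitMeasure_Iio_le _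

/-- Replacing the scale by its lower bound 2^n enlarges the event and makes it a preimage under the
measure-preserving map `T^[n]`. -/
lemma unitMeasure_approxSet_succ_le (hanti : AntitoneOn ψ (Ici 1)) (n : ℕ) :
    unitMeasure (approxSet ψ (n + 1)) ≤ cutoffSum ψ (2 ^ n) := by
  have hsub : approxSet ψ (n + 1) ⊆ T^[n] ⁻¹' rescaledApproxSet ψ (2 ^ n) := by
    intro x hx
    have hx0 := hx.1
    rw [mem_approxSet_succ ψ hx0] at hx
    have h2 := two_le_firstDigit (iterate_T_mem hx0 n)
    have h2' : (2 : ℝ) ≤ firstDigit (T^[n] x) := mod_cast h2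
    have h3 : 1 ≤ firstDigit (T^[n] x) * 2 ^ n := Nat.mul_pos (by omega) (by positivity)
    have h4 : firstDigit (T^[n] x) * 2 ^ n ≤ firstDigit (T^[n] x) * scale n x :=
      Nat.mul_le_mul_left _ (two_pow_le_scale hx0 n)
    refine lt_of_lt_of_le hx ?_
    exact mul_le_mul_of_nonneg_right (hanti h3 (h3.trans h4) h4) (by linarith)
  refine (measure_mono hsub).trans ?_
  rw [(measurePreserving_T.iterate n).measure_preimage
    (measurableSet_rescaledApproxSet ψ _).nullMeasurableSet]
  exact unitMeasure_rescaledApproxSet_le ψ _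

lemma unitMeasure_L_eq_zero (hanti : AntitoneOn ψ (Ici 1))
    (h : ∑' k : ℕ, cutoffSum ψ (2 ^ k) ≠ ⊤) : unitMeasure (L ψ) = 0 := by
  -- The shift discards rank 0, to which the error criterion does not apply, and leaves the limsup
  -- unchanged.
  rw [L_eq, ← limsup_nat_add _ 1]
  exact measure_limsup_atTop_eq_zero (ne_top_of_le_ne_top h
    (ENNReal.tsum_le_tsum (unitMeasure_approxSet_succ_le hanti)))

/-! ### Exponential growth of the scale -/

/-- The mean of the square root of a Lüroth digit. -/
noncomputable def sqrtMean : ℝ≥0∞ := ∑' m : ℕ, digitWeight m * ENNReal.ofReal √((m + 2 : ℕ) : ℝ)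

/-- The digits themselves have infinite mean; with the square root the terms are at most (m +
1)^(-3/2). -/
lemma sqrtMean_ne_top : sqrtMean ≠ ⊤ := by
  have hs : Summable fun m : ℕ => (((m + 1 : ℕ) : ℝ) ^ (3 / 2 : ℝ))⁻¹ :=
    (summable_nat_add_iff 1).2 (Real.summable_nat_rpow_inv.2 (by norm_num))
  refine ne_top_of_le_ne_top hs.tsum_ofReal_ne_top (ENNReal.tsum_le_tsum fun m => ?_)
  rw [digitWeight, ← ENNReal.ofReal_mul (by positivity)]
  gcongr
  have e : (((m + 1 : ℕ) : ℝ) ^ (3 / 2 : ℝ)) = (m + 1) * √(m + 1) := by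
    rw [show (3 / 2 : ℝ) = 1 + 1 / 2 by norm_num, Real.rpow_add (by positivity), Real.rpow_one,
      ← Real.sqrt_eq_rpow]
    push_cast
    rfl
  have hsq : √((m : ℝ) + 2) * √((m : ℝ) + 2) = m + 2 := Real.mul_self_sqrt (by positivity)
  have hle : √((m : ℝ) + 1) ≤ √((m : ℝ) + 2) := Real.sqrt_le_sqrt (by linarith)
  rw [e]
  push_cast
  rw [one_div_mul_eq_div, ← one_div, div_le_div_iff₀ (by positivity) (by positivity)]
  calc √((m : ℝ) + 2) * ((m + 1) * √(m + 1)) ≤ √((m : ℝ) + 2) * ((m + 1) * √(m + 2)) := by gcongr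
    _ = 1 * ((m + 1) * (m + 2)) := by linear_combination ((m : ℝ) + 1) * hsq

/-- The product of the square roots of the first `n` digits. -/
noncomputable def sqrtProd (n : ℕ) (x : ℝ) : ℝ≥0∞ :=
  ∏ j ∈ Finset.range n, ENNReal.ofReal √(firstDigit (T^[j] x) : ℝ)

lemma measurable_sqrtProd (n : ℕ) : Measurable (sqrtProd n) := by
  unfold sqrtProd
  refine Finset.measurable_fun_prod _ fun j _ => ?_
  exact ((measurable_comp_firstDigit fun d => √(d : ℝ)).comp
    (measurable_T.iterate j)).ennreal_ofReal

lemma lintegral_sqrtProd (n : ℕ) : ∫⁻ x, sqrtProd n x ∂unitMeasure = sqrtMean ^ n := by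
  induction n with
  | zero => simp [sqrtProd]
  | succ n ih =>
    have e (x : ℝ) : sqrtProd (n + 1) x =
        ENNReal.ofReal √(firstDigit x : ℝ) * sqrtProd n (T x) := by
      rw [sqrtProd, Finset.prod_range_succ', mul_comm]
      rfl
    simp only [e]
    rw [lintegral_firstDigit_T fun d y => ENNReal.ofReal √(d : ℝ) * sqrtProd n y]
    simp only [lintegral_const_mul _ (measurable_sqrtProd n), ih, ← mul_assoc]
    rw [ENNReal.tsum_mul_right, pow_succ', sqrtMean]

lemma scale_le_sqrtProd_pow (n : ℕ) (x : ℝ) : (scale n x : ℝ≥0∞) ≤ sqrtProd n x ^ 4 := by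
  induction n with
  | zero => simp [scale_zero, sqrtProd]
  | succ n ih =>
    rw [scale_succ, sqrtProd, Finset.prod_range_succ, mul_pow, ← sqrtProd, digit_succ]
    have h : ENNReal.ofReal √(firstDigit (T^[n] x) : ℝ) ^ 4
        = ((firstDigit (T^[n] x) * firstDigit (T^[n] x) : ℕ) : ℝ≥0∞) := by
      rw [← ENNReal.ofReal_pow (by positivity), ← ENNReal.ofReal_natCast]
      congr 1
      rw [show 4 = 2 * 2 by norm_num, pow_mul, Real.sq_sqrt (by positivity)]
      push_cast
      ring
    rw [h]
    push_cast
    gcongr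
    exact tsub_le_self

lemma exists_scale_le : ∃ a : ℕ, 0 < a ∧
    ∀ᵐ x ∂unitMeasure, ∀ᶠ n in atTop, scale n x ≤ 2 ^ (a * n) := by
  obtain ⟨b, hb⟩ := ENNReal.exists_nat_gt sqrtMean_ne_top
  have hb' : sqrtMean ≤ 2 ^ b := hb.le.trans (mod_cast (Nat.lt_two_pow_self (n := b)).le)
  -- The 4 comes from d (d - 1) ≤ (√d)^4. The extra 1 added to b leaves a summable factor 2^-n in
  -- Markov's inequality.
  refine ⟨4 * (b + 1), by omega, ?_⟩
  have hmarkov (n : ℕ) : unitMeasure {x | (2 : ℝ≥0∞) ^ ((b + 1) * n) ≤ sqrtProd n x}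
      ≤ (2⁻¹ : ℝ≥0∞) ^ n := by
    refine (meas_ge_le_lintegral_div (measurable_sqrtProd n).aemeasurable (by simp)
      (by simp)).trans ?_
    rw [lintegral_sqrtProd, ENNReal.div_le_iff (by simp) (by simp)]
    calc sqrtMean ^ n ≤ (2 ^ b) ^ n := by gcongr
      _ = (2⁻¹ * 2) ^ n * (2 ^ b) ^ n := by
        rw [ENNReal.inv_mul_cancel (by simp) (by simp), one_pow, one_mul]
      _ = 2⁻¹ ^ n * 2 ^ ((b + 1) * n) := by rw [pow_mul]; ring
  have hfin : ∑' n, unitMeasure {x | (2 : ℝ≥0∞) ^ ((b + 1) * n) ≤ sqrtProd n x} ≠ ⊤ := by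
    refine ne_top_of_le_ne_top ?_ (ENNReal.tsum_le_tsum hmarkov)
    rw [ENNReal.tsum_geometric]
    simp
  filter_upwards [ae_eventually_notMem hfin] with x hx
  filter_upwards [hx] with n hn
  have hlt : sqrtProd n x ≤ 2 ^ ((b + 1) * n) := (not_le.1 hn).le
  have : (scale n x : ℝ≥0∞) ≤ ((2 ^ (4 * (b + 1) * n) : ℕ) : ℝ≥0∞) := by
    calc (scale n x : ℝ≥0∞) ≤ sqrtProd n x ^ 4 := scale_le_sqrtProd_pow n x
      _ ≤ (2 ^ ((b + 1) * n)) ^ 4 := by gcongr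
      _ = _ := by
        push_cast
        rw [← pow_mul]
        ring_nf
  exact_mod_cast this

/-! ### The divergence case -/

/-- A set determined by the first two digits. -/
def pairSet (H : ℕ → ℕ → Prop) : Set ℝ := {x | H (firstDigit x) (firstDigit (T x))}

lemma measurableSet_pairSet (H : ℕ → ℕ → Prop) : MeasurableSet (pairSet H) :=
  (measurable_firstDigit.prodMk (measurable_firstDigit.comp measurable_T))
    (MeasurableSet.of_discrete (s := {p : ℕ × ℕ | H p.1 p.2}))

lemma unitMeasure_pairSet_inter (H : ℕ → ℕ → Prop) {D : Set ℝ} (hD : MeasurableSet D) :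
    unitMeasure (pairSet H ∩ T^[2] ⁻¹' D) = unitMeasure (pairSet H) * unitMeasure D := by
  classical
  have key (E : Set ℝ) (hE : MeasurableSet E) : unitMeasure (pairSet H ∩ T^[2] ⁻¹' E) =
      (∑' m, digitWeight m * ∑' l, digitWeight l * if H (m + 2) (l + 2) then 1 else 0)
        * unitMeasure E := by
    rw [← lintegral_indicator_one
      ((measurableSet_pairSet H).inter ((measurable_T.iterate 2) hE))]
    have h1 := lintegral_firstDigit_T
      fun d y => (if H d (firstDigit y) then 1 else 0) * E.indicator 1 (T y)
    have h2 (m : ℕ) := lintegral_firstDigit_T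
      fun d y => (if H (m + 2) d then 1 else 0) * E.indicator 1 y
    simp only [h2, lintegral_const_mul _ (measurable_one.indicator hE),
      lintegral_indicator_one hE, ← mul_assoc, ENNReal.tsum_mul_right] at h1
    rw [← h1]
    refine lintegral_congr fun x => ?_
    by_cases hx : H (firstDigit x) (firstDigit (T x)) <;>
      by_cases hx' : T (T x) ∈ E <;> simp [indicator, pairSet, hx, hx']
  -- Taking the whole line for E identifies the double series as the measure of `pairSet H`.
  have h := key univ MeasurableSet.univ
  simp only [preimage_univ, inter_univ, measure_univ, mul_one] at h
  rw [key D hD, h]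

lemma unitMeasure_iInter_pairSet (N : ℕ) (H : ℕ → ℕ → ℕ → Prop) :
    unitMeasure (⋂ k ∈ Finset.range N, T^[2 * k] ⁻¹' pairSet (H k))
      = ∏ k ∈ Finset.range N, unitMeasure (pairSet (H k)) := by
  induction N generalizing H with
  | zero => simp
  | succ N ih =>
    have e : ⋂ k ∈ Finset.range (N + 1), T^[2 * k] ⁻¹' pairSet (H k) = pairSet (H 0) ∩
        T^[2] ⁻¹' ⋂ k ∈ Finset.range N, T^[2 * k] ⁻¹' pairSet (H (k + 1)) := by
      ext x
      simp only [mem_iInter, Finset.mem_range, mem_inter_iff, mem_preimage,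
        ← Function.iterate_add_apply]
      constructor
      · exact fun h => ⟨h 0 (by omega), fun k hk => h (k + 1) (by omega)⟩
      · rintro ⟨h0, h⟩ (_ | k) hk
        · exact h0
        · exact h k (by omega)
    rw [e, unitMeasure_pairSet_inter, ih, Finset.prod_range_succ', mul_comm]
    exact Finset.measurableSet_biInter _ fun k _ =>
      (measurable_T.iterate _) (measurableSet_pairSet _)

lemma unitMeasure_preimage_pairSet (k : ℕ) (H : ℕ → ℕ → Prop) :
    unitMeasure (T^[k] ⁻¹' pairSet H) = unitMeasure (pairSet H) :=
  (measurePreserving_T.iterate k).measure_preimage (measurableSet_pairSet H).nullMeasurableSet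

/-- Events that concern disjoint pairs of consecutive digits are independent. -/
lemma iIndepSet_pairSet (H : ℕ → ℕ → ℕ → Prop) :
    ProbabilityTheory.iIndepSet (fun k => T^[2 * k] ⁻¹' pairSet (H k)) unitMeasure := by
  rw [ProbabilityTheory.iIndepSet_iff_meas_biInter
    fun k => (measurable_T.iterate _) (measurableSet_pairSet _)]
  intro s
  obtain ⟨N, hN⟩ := s.exists_nat_subset_range
  -- Indices outside s receive a vacuous condition, which reduces an arbitrary finite set of indices
  -- to an initial range.
  have h := unitMeasure_iInter_pairSet N fun k d d' => k ∈ s → H k d d'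
  have hs (k : ℕ) (hk : k ∈ s) : pairSet (fun d d' => k ∈ s → H k d d') = pairSet (H k) := by
    simp [hk]
  have hns (k : ℕ) (hk : k ∉ s) : pairSet (fun d d' => k ∈ s → H k d d') = univ := by
    simp [hk, pairSet]
  rw [← Finset.prod_subset hN fun k _ hk => by rw [hns k hk, measure_univ],
    Finset.prod_congr rfl fun k hk => by rw [hs k hk]] at h
  simp only [unitMeasure_preimage_pairSet]
  rw [← h]
  congr 1
  ext x
  simp only [mem_iInter, mem_preimage, Finset.mem_range]
  constructor
  · intro hx k _ hk
    exact hx k hk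
  · intro hx k hk
    exact hx k (Finset.mem_range.1 (hN hk)) hk

/-- The condition on two consecutive digits `d`, `d'`, the first of them at a cylinder of scale at
most `N`, that forces a good approximation. -/
def goodPair (ψ : ℕ → ℝ) (N d d' : ℕ) : Prop := 1 / ((d' : ℝ) - 1) < ψ (d * N) * ((d : ℝ) - 1)

/-- As d ≥ 2 and d y > 1, one has 1/(d - 1) ≤ 2/d < 2y, so every y in (0, min(1, c)/2] qualifies.
The factor 1/2 is the price of an event that depends on one digit only. -/
lemma half_ofReal_min_le (c : ℝ) : ENNReal.ofReal (min 1 c) / 2 ≤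
    unitMeasure {y | 1 / ((firstDigit y : ℝ) - 1) < c} := by
  have hsub : Ioc 0 (min 1 c / 2) ⊆ {y | 1 / ((firstDigit y : ℝ) - 1) < c} := by
    intro y hy
    have h1 := min_le_left 1 c
    have h2 := min_le_right 1 c
    have hy1 : y ∈ Ioc (0 : ℝ) 1 := ⟨hy.1, by linarith [hy.2]⟩
    have h3 : (2 : ℝ) ≤ firstDigit y := mod_cast two_le_firstDigit hy1
    have h4 := one_lt_firstDigit_mul hy1
    have h5 : (firstDigit y : ℝ) * y ≤ firstDigit y * (c / 2) := by
      gcongr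
      linarith [hy.2]
    have h6 : 0 < c := by linarith [hy.1, hy.2]
    change 1 / ((firstDigit y : ℝ) - 1) < c
    rw [div_lt_iff₀ (by linarith)]
    nlinarith
  refine le_trans (le_of_eq ?_) (measure_mono hsub)
  have hsub' : Ioc 0 (min 1 c / 2) ⊆ Ioc 0 1 := by
    refine Ioc_subset_Ioc_right ?_
    linarith [min_le_left 1 c]
  rw [unitMeasure, Measure.restrict_apply measurableSet_Ioc, inter_eq_left.2 hsub',
    Real.volume_Ioc, sub_zero, ENNReal.ofReal_div_of_pos (by norm_num)]
  simp

lemma cutoffSum_le_unitMeasure_pairSet (ψ : ℕ → ℝ) (N : ℕ) :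
    cutoffSum ψ N / 2 ≤ unitMeasure (pairSet (goodPair ψ N)) := by
  have hmeas (c : ℝ) : MeasurableSet {y | 1 / ((firstDigit y : ℝ) - 1) < c} :=
    measurableSet_lt (measurable_comp_firstDigit fun d => 1 / ((d : ℝ) - 1)) measurable_const
  have h := lintegral_firstDigit_T fun d =>
    {y | 1 / ((firstDigit y : ℝ) - 1) < ψ (d * N) * ((d : ℝ) - 1)}.indicator (1 : ℝ → ℝ≥0∞)
  simp only [lintegral_indicator_one (hmeas _)] at h
  rw [← lintegral_indicator_one (measurableSet_pairSet _)]
  refine le_trans ?_ h.ge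
  rw [cutoffSum, ENNReal.div_eq_inv_mul, ← ENNReal.tsum_mul_left]
  refine ENNReal.tsum_le_tsum fun m => ?_
  rw [← digitWeight_mul_ofReal_min, cast_add_two_sub_one, ← ENNReal.div_eq_inv_mul, mul_div_assoc]
  gcongr
  exact half_ofReal_min_le _

lemma mem_approxSet_of_goodPair (hanti : AntitoneOn ψ (Ici 1)) {x : ℝ} (hx : x ∈ Ioc (0 : ℝ) 1)
    {n N : ℕ} (hN : scale n x ≤ N) (h : T^[n] x ∈ pairSet (goodPair ψ N)) :
    x ∈ approxSet ψ (n + 1) := by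
  rw [mem_approxSet_succ ψ hx]
  set y := T^[n] x with hy
  have hy1 : y ∈ Ioc (0 : ℝ) 1 := iterate_T_mem hx n
  have h2 := two_le_firstDigit hy1
  have h2' : (2 : ℝ) ≤ firstDigit y := mod_cast h2
  have h3 : 1 ≤ firstDigit y * scale n x := Nat.mul_pos (by omega) (scale_pos hx n)
  have h4 : firstDigit y * scale n x ≤ firstDigit y * N := Nat.mul_le_mul_left _ hN
  have h5 := hanti h3 (h3.trans h4) h4
  have h6 : (2 : ℝ) ≤ firstDigit (T y) := mod_cast two_le_firstDigit (mapsTo_T hy1)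
  have h7 : T y ≤ 1 / ((firstDigit (T y) : ℝ) - 1) := by
    rw [le_div_iff₀' (by linarith)]
    exact firstDigit_sub_one_mul_le (mapsTo_T hy1)
  exact (h7.trans_lt h).trans_le (mul_le_mul_of_nonneg_right h5 (by linarith))

lemma unitMeasure_L_eq_one (hanti : AntitoneOn ψ (Ici 1))
    (h : ∑' k : ℕ, cutoffSum ψ (2 ^ k) = ⊤) : unitMeasure (L ψ) = 1 := by
  obtain ⟨a, ha, hscale⟩ := exists_scale_le
  -- The event of index k involves only the digits of ranks 2k + 1 and 2k + 2, and its threshold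
  -- uses the deterministic bound for the scale at rank 2k.
  set s : ℕ → Set ℝ := fun k => T^[2 * k] ⁻¹' pairSet (goodPair ψ (2 ^ (a * (2 * k)))) with hs
  have hmeas (k : ℕ) : MeasurableSet (s k) := (measurable_T.iterate _) (measurableSet_pairSet _)
  have htop : ∑' k, unitMeasure (s k) = ⊤ := by
    have h2 := tsum_cutoffSum_pow_eq_top hanti (a := 2 * a) (by omega) h
    refine top_le_iff.1 ?_
    calc ⊤ = (∑' k : ℕ, cutoffSum ψ (2 ^ (2 * a * k))) / 2 := by
          rw [h2, ENNReal.top_div_of_ne_top (by simp)]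
      _ = ∑' k : ℕ, cutoffSum ψ (2 ^ (a * (2 * k))) / 2 := by
          simp only [div_eq_mul_inv, ENNReal.tsum_mul_right, mul_comm 2 a, mul_assoc]
      _ ≤ ∑' k, unitMeasure (s k) := by
          refine ENNReal.tsum_le_tsum fun k => ?_
          rw [hs]
          simp only [unitMeasure_preimage_pairSet]
          exact cutoffSum_le_unitMeasure_pairSet ψ _
  have hone := ProbabilityTheory.measure_limsup_eq_one hmeas
    (iIndepSet_pairSet fun k => goodPair ψ (2 ^ (a * (2 * k)))) htop
  have hlim : ∀ᵐ x ∂unitMeasure, x ∈ limsup s atTop :=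
    (mem_ae_iff_prob_eq_one (MeasurableSet.measurableSet_limsup hmeas)).2 hone
  refine (mem_ae_iff_prob_eq_one (measurableSet_L ψ)).1 ?_
  filter_upwards [hlim, hscale, ae_mem_unit] with x hx1 hx2 hx
  rw [mem_limsup_iff_frequently_mem] at hx1
  rw [L_eq, mem_limsup_iff_frequently_mem]
  have htend : Tendsto (fun k : ℕ => 2 * k) atTop atTop :=
    tendsto_id.const_mul_atTop' (by norm_num)
  -- The deterministic scale bound holds from some rank on, so infinitely many of the good pairs
  -- occur where it is valid.
  have hfreq : ∃ᶠ k in atTop, x ∈ approxSet ψ (2 * k + 1) :=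
    (hx1.and_eventually (htend.eventually hx2)).mono fun k hk =>
      mem_approxSet_of_goodPair hanti hx hk.2 hk.1
  exact ((tendsto_add_atTop_nat 1).comp htend).frequently hfreq

end Luroth

theorem theorem1 (ψ : ℕ → ℝ)
    (hψ : ∀ q : ℕ, 1 ≤ q → ψ q ∈ Set.Ioc (0 : ℝ) 1)
    (hanti : AntitoneOn ψ (Set.Ici 1))
    (hne : ∃ q : ℕ, 1 ≤ q ∧ ψ q ≠ 1) :
    MeasurableSet (Luroth.L ψ) ∧
    (Summable (fun q : ℕ => -ψ (q + 1) * Real.log (ψ (q + 1)) / ((q : ℝ) + 1)) →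
      MeasureTheory.volume (Luroth.L ψ) = 0) ∧
    (¬ Summable (fun q : ℕ => -ψ (q + 1) * Real.log (ψ (q + 1)) / ((q : ℝ) + 1)) →
      MeasureTheory.volume (Luroth.L ψ) = 1) := by
  rw [← Luroth.summable_gauge_iff hψ hanti hne, ← Luroth.summable_gauge_two_pow_iff hψ hanti,
    Luroth.volume_L]
  refine ⟨Luroth.measurableSet_L ψ, fun h => ?_, fun h => ?_⟩
  · exact Luroth.unitMeasure_L_eq_zero hanti (Luroth.tsum_cutoffSum_ne_top hψ hanti h)
  · refine Luroth.unitMeasure_L_eq_one hanti ?_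
    by_contra hfin
    exact h (Luroth.summable_gauge_of_tsum_cutoffSum_ne_top hψ hanti hfin)
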